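/- Let $n\ge 2$. For a continuous map $f\colon X\to Y$ of topological spaces, $\mathrm{secat}(f)\in\{0,1,2,\dots\}\cup\{\infty\}$ denotes the least integer $r\ge 0$ for which $Y$ has an open cover $W_0,\dots,W_r$ such that for each $i$ there is a continuous map $s_i\colon W_i\to X$ with $f\circ s_i$ homotopic to the inclusion $W_i\hookrightarrow Y$; if there is no such $r$, then $\mathrm{secat}(f)=\infty$. For a (Hurewicz) fibration $p\colon E\to B$, put $$E^n_B=\{(e_1,\dots,e_n)\in E^n \mid p(e_1)=\dots=p(e_n)\},\qquad E^I_B=\{\gamma\colon [0,1]\to E \text{ continuous}\mid p\circ\gamma \text{ is constant}\},$$ with the subspace topologies from the product $E^n$ and from the path space $E^{[0,1]}$ with the compact-open topology, let $$\Pi_n\colon E^I_B\to E^n_B,\qquad \Pi_n(\gamma)=\Bigl(\gamma(0),\gamma\bigl(\tfrac{1}{n-1}\bigr),\dots,\gamma\bigl(\tfrac{n-2}{n-1}\bigr),\gamma(1)\Bigr),$$ and define the $n$-th sequential parametrized topological complexity of $p$ by $\mathrm{TC}_n[p\colon E\to B]=\mathrm{secat}(\Pi_n)$. **Proposition.** Let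 $p\colon E\to B$ and $q\colon X\to Y$ be (Hurewicz) fibrations. If there are homotopy equivalences $f'\colon E\to X$ and $f\colon B\to Y$ with $q\circ f'=f\circ p$, then $$\mathrm{TC}_n[p\colon E\to B]=\mathrm{TC}_n[q\colon X\to Y].$$ -/

import Mathlib

open scoped unitInterval

universe u v

/-- A continuous map `p : E → B` is a (Hurewicz) fibration if it has the homotopy lifting property
with respect to all spaces `A`. Spaces `A` in the universe of the mapping path space of `p` suffice
to detect the homotopy lifting property for spaces in every universe. -/
def IsHurewiczFibration {E : Type u} {B : Type v} [TopologicalSpace E] [TopologicalSpace B]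
    (p : C(E, B)) : Prop :=
  ∀ (A : Type (max u v)) [TopologicalSpace A] (g : C(A, E)) (H : C(A × I, B)),
    (∀ a : A, H (a, 0) = p (g a)) →
      ∃ G : C(A × I, E), (∀ a : A, G (a, 0) = g a) ∧ ∀ x : A × I, p (G x) = H x

/-- A subset `W` of `Y` admits a homotopy section of `f : X → Y` if there is a continuous map
`s : W → X` such that `f ∘ s` is homotopic to the inclusion of `W` in `Y`. -/
def HasHomotopySection {X : Type u} {Y : Type v} [TopologicalSpace X] [TopologicalSpace Y]
    (f : C(X, Y)) (W : Set Y) : Prop :=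
  ∃ s : C(W, X), (f.comp s).Homotopic ⟨Subtype.val, continuous_subtype_val⟩

/-- The sectional category of `f : X → Y`: the least `r` such that `Y` has an open cover
`W₀, …, W_r` each of whose members admits a homotopy section of `f`, and `∞` if there is
no such `r`. -/
noncomputable def secat {X : Type u} {Y : Type v} [TopologicalSpace X] [TopologicalSpace Y]
    (f : C(X, Y)) : ℕ∞ :=
  sInf {k : ℕ∞ | ∃ r : ℕ, k = (r : ℕ∞) ∧ ∃ W : Fin (r + 1) → Set Y,
    (∀ i, IsOpen (W i)) ∧ (⋃ i, W i) = Set.univ ∧ ∀ i, HasHomotopySection f (W i)}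

/-- The `n`-fold fibre product `E^n_B`, the space of `n`-tuples of points of `E` that lie in a
common fibre of `p`, as a subspace of the product `E^n`. -/
abbrev FibreProduct {E : Type u} {B : Type v} [TopologicalSpace E] [TopologicalSpace B]
    (p : C(E, B)) (n : ℕ) : Type u :=
  {e : Fin n → E // ∀ i j : Fin n, p (e i) = p (e j)}

/-- The space `E^I_B` of paths `γ : [0,1] → E` that stay in a single fibre of `p`, as a subspace
of the path space `E^I` with the compact-open topology. -/
abbrev FibrewisePathSpace {E : Type u} {B : Type v} [TopologicalSpace E] [TopologicalSpace B]
    (p : C(E, B)) : Type u :=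
  {γ : C(I, E) // ∃ b : B, ∀ t : I, p (γ t) = b}

/-- The point `i / (n - 1)` of the unit interval, for `i = 0, …, n - 1`. -/
noncomputable def timePoint (n : ℕ) (i : Fin n) : I :=
  ⟨(i : ℝ) / ((n : ℝ) - 1), by
    have h : (i : ℝ) + 1 ≤ (n : ℝ) := by exact_mod_cast i.isLt
    have h0 : (0 : ℝ) ≤ (i : ℝ) := Nat.cast_nonneg _
    exact ⟨div_nonneg h0 (by linarith), div_le_one_of_le₀ (by linarith) (by linarith)⟩⟩

/-- The parametrised endpoint map `Π_n : E^I_B → E^n_B`,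
`γ ↦ (γ(0), γ(1/(n-1)), …, γ((n-2)/(n-1)), γ(1))`. -/
noncomputable def endpointMap {E : Type u} {B : Type v} [TopologicalSpace E] [TopologicalSpace B]
    (p : C(E, B)) (n : ℕ) : C(FibrewisePathSpace p, FibreProduct p n) where
  toFun γ := ⟨fun i => γ.1 (timePoint n i), fun i j => by
    obtain ⟨b, hb⟩ := γ.2
    rw [hb, hb]⟩
  continuous_toFun := by
    refine Continuous.subtype_mk (continuous_pi fun i => ?_) _
    exact (continuous_eval_const (timePoint n i)).comp continuous_subtype_val

/-- The `n`-th sequential parametrized topological complexity `TC_n[p : E → B]`. -/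
noncomputable def sequentialParametrizedTC {E : Type u} {B : Type v} [TopologicalSpace E]
    [TopologicalSpace B] (n : ℕ) (p : C(E, B)) : ℕ∞ :=
  secat (endpointMap p n)

/-! A fibre preserving map induces a commutative square between the maps `Π_n`, and `secat` cannot
increase along a square whose map of codomains has a right homotopy inverse. So it is enough to give
`f'` a right inverse up to fibre preserving homotopy, and then the same for that inverse. A homotopy
inverse of `f'` is moved over `f.invFun` by homotopy lifting. Its composite with `f'` is then
fibrewise homotopic to a self-map over `Y`, which is homotopic to the identity and, as in Dold's
theorem, has a vertical right inverse; precomposing with that inverse corrects the map. -/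

open ContinuousMap

/-! ### Sectional category and commutative squares -/

section SectionalCategory

variable {A A' B B' : Type*} [TopologicalSpace A] [TopologicalSpace A'] [TopologicalSpace B]
  [TopologicalSpace B']

/-- Homotopy sections can be transported along a commutative square whose map of codomains has a
right homotopy inverse. -/
theorem HasHomotopySection.preimage {f : C(A, B)} {f' : C(A', B')} {a : C(A, A')} {b : C(B, B')}
    {c : C(B', B)} (hab : f'.comp a = b.comp f)
    (hbc : (b.comp c).Homotopic (ContinuousMap.id B')) {W : Set B} (hW : HasHomotopySection f W) :
    HasHomotopySection f' (c ⁻¹' W) := by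
  obtain ⟨s, hs⟩ := hW
  let r : C(c ⁻¹' W, W) := ⟨fun v => ⟨c v.1, v.2⟩, by fun_prop⟩
  refine ⟨(a.comp s).comp r, ?_⟩
  have h₁ : (b.comp ((f.comp s).comp r)).Homotopic
      (b.comp ((⟨Subtype.val, continuous_subtype_val⟩ : C(W, B)).comp r)) :=
    (Homotopic.refl b).comp (hs.comp (Homotopic.refl r))
  have h₂ : ((b.comp c).comp (⟨Subtype.val, continuous_subtype_val⟩ : C(c ⁻¹' W, B'))).Homotopic
      ((ContinuousMap.id B').comp ⟨Subtype.val, continuous_subtype_val⟩) :=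
    hbc.comp (Homotopic.refl _)
  have h₃ : f'.comp ((a.comp s).comp r) = b.comp ((f.comp s).comp r) := by
    ext v
    exact DFunLike.congr_fun hab (s (r v))
  rw [h₃]
  exact h₁.trans h₂

/-- The sectional category does not increase along a commutative square whose map of codomains has
a right homotopy inverse. -/
theorem secat_le_of_homotopic {f : C(A, B)} {f' : C(A', B')} {a : C(A, A')} {b : C(B, B')}
    {c : C(B', B)} (hab : f'.comp a = b.comp f)
    (hbc : (b.comp c).Homotopic (ContinuousMap.id B')) : secat f' ≤ secat f := by
  refine sInf_le_sInf ?_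
  rintro _ ⟨r, rfl, W, hopen, hcover, hsec⟩
  refine ⟨r, rfl, fun i => c ⁻¹' W i, fun i => (hopen i).preimage c.continuous, ?_,
    fun i => (hsec i).preimage hab hbc⟩
  rw [← Set.preimage_iUnion, hcover, Set.preimage_univ]

end SectionalCategory

/-! ### Functoriality of `Π_n` in fibre preserving maps -/

section FibrePreserving

variable {E B X Y : Type*} [TopologicalSpace E] [TopologicalSpace B] [TopologicalSpace X]
  [TopologicalSpace Y]

/-- A map between the total spaces of `p` and `q` is fibre preserving if it sends every fibre of
`p` into a fibre of `q`. -/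
def FibrePreserving (p : C(E, B)) (q : C(X, Y)) (φ : C(E, X)) : Prop :=
  ∀ e e' : E, p e = p e' → q (φ e) = q (φ e')

theorem FibrePreserving.of_comp_eq {p : C(E, B)} {q : C(X, Y)} {φ : C(E, X)} (f : C(B, Y))
    (h : ∀ e, q (φ e) = f (p e)) : FibrePreserving p q φ := fun e e' he => by
  rw [h, h, he]

variable {p : C(E, B)} {q : C(X, Y)}

/-- The map of fibre products induced by a fibre preserving map. -/
def FibrePreserving.fibreProductMap {φ : C(E, X)} (h : FibrePreserving p q φ) (n : ℕ) :
    C(FibreProduct p n, FibreProduct q n) where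
  toFun e := ⟨fun i => φ (e.1 i), fun i j => h _ _ (e.2 i j)⟩
  continuous_toFun := Continuous.subtype_mk (continuous_pi fun i =>
    φ.continuous.comp ((continuous_apply i).comp continuous_subtype_val)) _

/-- The map of fibrewise path spaces induced by a fibre preserving map. -/
def FibrePreserving.pathSpaceMap {φ : C(E, X)} (h : FibrePreserving p q φ) :
    C(FibrewisePathSpace p, FibrewisePathSpace q) where
  toFun γ := ⟨φ.comp γ.1, q (φ (γ.1 0)), fun t => h _ _ <| by
    obtain ⟨b, hb⟩ := γ.2
    rw [hb, hb]⟩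
  continuous_toFun := ((continuous_postcomp φ).comp continuous_subtype_val).subtype_mk _

/-- A homotopy through fibre preserving maps to the identity induces a homotopy on fibre
products. -/
theorem FibrePreserving.fibreProductMap_comp_homotopic_id {φ : C(E, X)} {ψ : C(X, E)}
    (hφ : FibrePreserving p q φ) (hψ : FibrePreserving q p ψ)
    (h : HomotopicWith (φ.comp ψ) (ContinuousMap.id X) (FibrePreserving q q)) (n : ℕ) :
    ((hφ.fibreProductMap n).comp (hψ.fibreProductMap n)).Homotopic
      (ContinuousMap.id (FibreProduct q n)) := by
  obtain ⟨F⟩ := h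
  refine ⟨⟨⟨fun z => ⟨fun i => F (z.1, z.2.1 i), fun i j => F.prop z.1 _ _ (z.2.2 i j)⟩, ?_⟩,
    fun z => ?_, fun z => ?_⟩⟩
  · exact Continuous.subtype_mk (continuous_pi fun i => F.continuous.comp <|
      continuous_fst.prodMk <| (continuous_apply i).comp <|
        continuous_subtype_val.comp continuous_snd) _
  · exact Subtype.ext (funext fun i => F.apply_zero _)
  · exact Subtype.ext (funext fun i => F.apply_one _)

/-- Evaluating a path commutes with applying `φ`, so the square is strict (`rfl`). Only a one-sided
inverse is needed. -/
theorem sequentialParametrizedTC_le {φ : C(E, X)} {ψ : C(X, E)}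
    (hφ : FibrePreserving p q φ) (hψ : FibrePreserving q p ψ)
    (h : HomotopicWith (φ.comp ψ) (ContinuousMap.id X) (FibrePreserving q q)) (n : ℕ) :
    sequentialParametrizedTC n q ≤ sequentialParametrizedTC n p :=
  secat_le_of_homotopic (a := hφ.pathSpaceMap) (b := hφ.fibreProductMap n)
    (c := hψ.fibreProductMap n) rfl (hφ.fibreProductMap_comp_homotopic_id hψ h n)

end FibrePreserving

/-! ### Path lifting and vertical homotopies -/

section Fibration

variable {E B A : Type*} [TopologicalSpace E] [TopologicalSpace B] [TopologicalSpace A]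

/-- The mapping path space of `p : E → B`. -/
abbrev MappingPathSpace (p : C(E, B)) :=
  {z : E × C(I, B) // z.2 0 = p z.1}

/-- A path lifting function for `p`. -/
structure PathLifting (p : C(E, B)) where
  /-- The lift of a path with a given starting point, as a function of time. -/
  lift : C(MappingPathSpace p × I, E)
  lift_zero : ∀ z, lift (z, 0) = z.1.1
  proj_lift : ∀ z t, p (lift (z, t)) = z.1.2 t

/-- Evaluation of paths is the universal homotopy to lift, and its lift is a lifting function. -/
theorem IsHurewiczFibration.nonempty_pathLifting {p : C(E, B)} (hp : IsHurewiczFibration p) :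
    Nonempty (PathLifting p) := by
  obtain ⟨G, hG₀, hG⟩ := hp (MappingPathSpace p)
    ⟨fun z => z.1.1, by fun_prop⟩ ⟨fun x => x.1.1.2 x.2, by fun_prop⟩ fun a => a.2
  exact ⟨⟨G, hG₀, fun z t => hG (z, t)⟩⟩

namespace PathLifting

variable {p : C(E, B)}

/-- The lift of a homotopy `H` starting at `g`, obtained by lifting its paths one by one. -/
def liftHomotopy (T : PathLifting p) (g : C(A, E)) (H : C(A × I, B))
    (h : ∀ a, H (a, 0) = p (g a)) : C(A × I, E) where
  toFun x := T.lift (⟨(g x.1, H.curry x.1), h x.1⟩, x.2)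
  continuous_toFun := by fun_prop

@[simp]
theorem liftHomotopy_zero (T : PathLifting p) (g : C(A, E)) (H : C(A × I, B))
    (h : ∀ a, H (a, 0) = p (g a)) (a : A) :
    T.liftHomotopy g H h (a, 0) = g a :=
  T.lift_zero _

@[simp]
theorem proj_liftHomotopy (T : PathLifting p) (g : C(A, E)) (H : C(A × I, B))
    (h : ∀ a, H (a, 0) = p (g a)) (x : A × I) : p (T.liftHomotopy g H h x) = H x :=
  T.proj_lift _ _

/-- Lifting depends only on the initial value and the path in the base. -/
theorem liftHomotopy_congr (T : PathLifting p) {A' : Type*} [TopologicalSpace A'] {g : C(A, E)}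
    {H : C(A × I, B)} {h : ∀ a, H (a, 0) = p (g a)} {g' : C(A', E)}
    {H' : C(A' × I, B)} {h' : ∀ a, H' (a, 0) = p (g' a)} {a : A} {a' : A'} (hg : g a = g' a')
    (hH : ∀ t, H (a, t) = H' (a', t)) (t : I) :
    T.liftHomotopy g H h (a, t) = T.liftHomotopy g' H' h' (a', t) := by
  have : H.curry a = H'.curry a' := ContinuousMap.ext hH
  simp only [liftHomotopy, ContinuousMap.coe_mk, hg, this]

/-- The end of any lift `G` of a homotopy is vertically homotopic to the end of the lift with the
same start that is given by the path lifting function. -/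
theorem homotopicWith_liftHomotopy (T : PathLifting p) (G : C(A × I, E)) (H : C(A × I, B))
    (hG : ∀ x, p (G x) = H x) (g : C(A, E)) (hg : ∀ a, G (a, 0) = g a)
    (h : ∀ a, H (a, 0) = p (g a)) (k : C(A, E)) (hk : ∀ a, G (a, 1) = k a) :
    HomotopicWith k ⟨fun a => T.liftHomotopy g H h (a, 1), by fun_prop⟩
      (fun φ => ∀ a, p (φ a) = H (a, 1)) := by
  -- The path `t ↦ H (a, max s t)` is lifted from `G (a, s)`. On the edges `s = 1` and `t = 1` it
  -- stays at `H (a, 1)`, so both `k` and the end of the canonical lift (`s = 0`) move vertically to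
  -- the corner `m`.
  let H' : C((A × I) × I, B) := ⟨fun z => H (z.1.1, max z.1.2 z.2), by fun_prop⟩
  have h' : ∀ x, H' (x, 0) = p (G x) := fun x => by
    rw [hG]
    exact congrArg (fun t => H (x.1, t)) (max_eq_left x.2.2.1)
  let L := T.liftHomotopy G H' h'
  have hmax : ∀ t : I, max 1 t = 1 := fun t => max_eq_left t.2.2
  have hmax' : ∀ t : I, max t 1 = 1 := fun t => max_eq_right t.2.2
  let m : C(A, E) := ⟨fun a => L ((a, 1), 1), by fun_prop⟩
  have h₁ : HomotopicWith k m (fun φ => ∀ a, p (φ a) = H (a, 1)) := by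
    refine ⟨⟨⟨⟨fun z => L ((z.2, 1), z.1), by fun_prop⟩, fun a => ?_, fun a => rfl⟩,
      fun t a => ?_⟩⟩
    · exact (T.liftHomotopy_zero G H' h' (a, 1)).trans (hk a)
    · refine (T.proj_liftHomotopy _ _ h' _).trans ?_
      exact congrArg (fun t => H (a, t)) (hmax t)
  have h₂ : HomotopicWith ⟨fun a => T.liftHomotopy g H h (a, 1), by fun_prop⟩ m
      (fun φ => ∀ a, p (φ a) = H (a, 1)) := by
    refine ⟨⟨⟨⟨fun z => L ((z.2, z.1), 1), by fun_prop⟩, fun a => ?_, fun a => rfl⟩,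
      fun t a => ?_⟩⟩
    · refine T.liftHomotopy_congr (h := h') (h' := h) (hg a) (fun t => ?_) 1
      exact congrArg (fun t => H (a, t)) (max_eq_right t.2.1)
    · refine (T.proj_liftHomotopy _ _ h' _).trans ?_
      exact congrArg (fun t => H (a, t)) (hmax' t)
  exact h₁.trans h₂.symm

/-- The ends of two lifts of the same homotopy with the same start are vertically homotopic. -/
theorem homotopicWith_of_lifts (T : PathLifting p) (G G' : C(A × I, E))
    (hG : ∀ x, p (G x) = p (G' x))
    (h₀ : ∀ a, G (a, 0) = G' (a, 0)) (k k' : C(A, E)) (hk : ∀ a, G (a, 1) = k a)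
    (hk' : ∀ a, G' (a, 1) = k' a) :
    HomotopicWith k k' (fun φ => ∀ a, p (φ a) = p (k' a)) := by
  have hs := T.homotopicWith_liftHomotopy G (p.comp G') hG ⟨fun a => G' (a, 0), by fun_prop⟩ h₀
    (fun _ => rfl) k hk
  have hs' := T.homotopicWith_liftHomotopy G' (p.comp G') (fun _ => rfl)
    ⟨fun a => G' (a, 0), by fun_prop⟩ (fun _ => rfl) (fun _ => rfl) k' hk'
  have := hs.trans hs'.symm
  simpa only [ContinuousMap.comp_apply, hk'] using this

/-- A self-map over the base that is homotopic to the identity has a right inverse up to vertical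
homotopy, which is itself homotopic to the identity. -/
theorem exists_vertical_rightInverse (T : PathLifting p) (k : C(E, E)) (hk : ∀ e, p (k e) = p e)
    (hkid : k.Homotopic (ContinuousMap.id E)) :
    ∃ m : C(E, E), (∀ e, p (m e) = p e) ∧ m.Homotopic (ContinuousMap.id E) ∧
      HomotopicWith (k.comp m) (ContinuousMap.id E) (fun φ => ∀ e, p (φ e) = p e) := by
  obtain ⟨K⟩ := hkid
  let K' : C(E × I, E) := ⟨fun x => K (x.2, x.1), by fun_prop⟩
  have h₀ : ∀ e, p.comp K' (e, 0) = p (ContinuousMap.id E e) := fun e => by simp [K', hk]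
  let M := T.liftHomotopy (ContinuousMap.id E) (p.comp K') h₀
  let m : C(E, E) := ⟨fun e => M (e, 1), by fun_prop⟩
  refine ⟨m, fun e => ?_, Homotopic.symm
    ⟨⟨⟨fun z => M (z.2, z.1), by fun_prop⟩, fun e => ?_, fun e => rfl⟩⟩, ?_⟩
  · exact (T.proj_liftHomotopy _ _ h₀ _).trans (by simp [K'])
  · exact T.liftHomotopy_zero _ _ h₀ _
  -- Both `k ∘ M` and `K'` start at `k` and lift `p ∘ K'`; they end at `k ∘ m` and the identity.
  · refine T.homotopicWith_of_lifts (k.comp M) K' (fun x => ?_) (fun e => ?_) _ _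
      (fun e => rfl) fun e => ?_
    · exact (hk _).trans (T.proj_liftHomotopy _ _ h₀ _)
    · simp [M, K']
    · simp [K']

/-- A map that lies over `f` up to homotopy is homotopic to a map over `f`. -/
theorem exists_homotopic_over (T : PathLifting p) (g : C(A, E)) (f : C(A, B))
    (h : (p.comp g).Homotopic f) :
    ∃ g' : C(A, E), g.Homotopic g' ∧ p.comp g' = f := by
  obtain ⟨F⟩ := h
  let H : C(A × I, B) := ⟨fun x => F (x.2, x.1), by fun_prop⟩
  have h₀ : ∀ a, H (a, 0) = p (g a) := F.apply_zero
  let G := T.liftHomotopy g H h₀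
  refine ⟨⟨fun a => G (a, 1), by fun_prop⟩,
    ⟨⟨⟨fun z => G (z.2, z.1), by fun_prop⟩, fun a => ?_, fun a => rfl⟩⟩, ?_⟩
  · exact T.liftHomotopy_zero _ _ h₀ _
  · ext a
    exact (T.proj_liftHomotopy _ _ h₀ _).trans (F.apply_one a)

/-- A self-map over a map of the base that is homotopic to the identity is homotopic, through fibre
preserving maps, to a self-map over the base. -/
theorem exists_homotopicWith_over_id (T : PathLifting p) (k : C(E, E)) (f : C(B, B))
    (hk : p.comp k = f.comp p) (hf : f.Homotopic (ContinuousMap.id B)) :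
    ∃ k' : C(E, E), (∀ e, p (k' e) = p e) ∧ HomotopicWith k k' (FibrePreserving p p) := by
  obtain ⟨F⟩ := hf
  let H : C(E × I, B) := ⟨fun x => F (x.2, p x.1), by fun_prop⟩
  have h₀ : ∀ e, H (e, 0) = p (k e) := fun e =>
    (F.apply_zero (p e)).trans (DFunLike.congr_fun hk e).symm
  let G := T.liftHomotopy k H h₀
  refine ⟨⟨fun a => G (a, 1), by fun_prop⟩, fun e => ?_,
    ⟨⟨⟨⟨fun z => G (z.2, z.1), by fun_prop⟩, fun a => ?_, fun a => rfl⟩, fun t => ?_⟩⟩⟩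
  · exact (T.proj_liftHomotopy _ _ h₀ _).trans (F.apply_one _)
  · exact T.liftHomotopy_zero _ _ h₀ _
  · exact .of_comp_eq (F.curry t) fun e => T.proj_liftHomotopy _ _ h₀ _

end PathLifting

end Fibration

/-! ### Fibrewise inverses and invariance -/

section HomotopyInvariance

variable {E B X Y : Type*} [TopologicalSpace E] [TopologicalSpace B] [TopologicalSpace X]
  [TopologicalSpace Y]

/-- A map of fibrations consisting of homotopy equivalences has a right inverse up to fibre
preserving homotopy, which again consists of homotopy equivalences. -/
theorem exists_fibrewise_rightInverse {p : C(E, B)} {q : C(X, Y)} (hp : IsHurewiczFibration p)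
    (hq : IsHurewiczFibration q) (f' : HomotopyEquiv E X) (f : HomotopyEquiv B Y)
    (hcomm : q.comp f'.toFun = f.toFun.comp p) :
    ∃ g' : HomotopyEquiv X E, p.comp g'.toFun = f.invFun.comp q ∧
      HomotopicWith (f'.toFun.comp g'.toFun) (ContinuousMap.id X) (FibrePreserving q q) := by
  obtain ⟨S⟩ := hp.nonempty_pathLifting
  obtain ⟨T⟩ := hq.nonempty_pathLifting
  have hover : (p.comp f'.invFun).Homotopic (f.invFun.comp q) := by
    have h₁ : ((f.invFun.comp f.toFun).comp (p.comp f'.invFun)).Homotopic (p.comp f'.invFun) :=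
      f.left_inv.comp (Homotopic.refl (p.comp f'.invFun))
    have h₂ : ((f.invFun.comp q).comp (f'.toFun.comp f'.invFun)).Homotopic (f.invFun.comp q) :=
      (Homotopic.refl (f.invFun.comp q)).comp f'.right_inv
    have h₃ : (f.invFun.comp f.toFun).comp (p.comp f'.invFun) =
        (f.invFun.comp q).comp (f'.toFun.comp f'.invFun) := by
      ext x
      exact congrArg f.invFun (DFunLike.congr_fun hcomm (f'.invFun x)).symm
    exact h₁.symm.trans (h₃ ▸ h₂)
  obtain ⟨g₁, hg₁, hpg₁⟩ := S.exists_homotopic_over f'.invFun (f.invFun.comp q) hover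
  have hcover : q.comp (f'.toFun.comp g₁) = (f.toFun.comp f.invFun).comp q := by
    ext x
    exact (DFunLike.congr_fun hcomm (g₁ x)).trans (congrArg f.toFun (DFunLike.congr_fun hpg₁ x))
  obtain ⟨k, hk, ⟨K⟩⟩ := T.exists_homotopicWith_over_id _ _ hcover f.right_inv
  have hkid : k.Homotopic (ContinuousMap.id X) :=
    (Homotopic.symm ⟨K.toHomotopy⟩).trans
      (((Homotopic.refl f'.toFun).comp hg₁.symm).trans f'.right_inv)
  obtain ⟨m, hm, hmid, ⟨M⟩⟩ := T.exists_vertical_rightInverse k hk hkid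
  -- The corrected map is still a homotopy inverse of `f'`, so the construction can be applied to it
  -- again.
  have hgm : (g₁.comp m).Homotopic f'.invFun :=
    ((Homotopic.refl g₁).comp hmid).trans hg₁.symm
  refine ⟨⟨g₁.comp m, f'.toFun, ((Homotopic.refl f'.toFun).comp hgm).trans f'.right_inv,
    (hgm.comp (Homotopic.refl f'.toFun)).trans f'.left_inv⟩, ?_, ?_⟩
  · ext x
    exact (DFunLike.congr_fun hpg₁ (m x)).trans (congrArg f.invFun (hm x))
  · have h₁ : HomotopicWith (f'.toFun.comp (g₁.comp m)) (k.comp m) (FibrePreserving q q) :=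
      ⟨⟨K.toHomotopy.compContinuousMap m, fun t x y hxy =>
        K.prop t _ _ ((hm x).trans (hxy.trans (hm y).symm))⟩⟩
    have h₂ : HomotopicWith (k.comp m) (ContinuousMap.id X) (FibrePreserving q q) :=
      ⟨⟨M.toHomotopy, fun t => .of_comp_eq (ContinuousMap.id Y) (M.prop t)⟩⟩
    exact h₁.trans h₂

end HomotopyInvariance

theorem mainTheorem6 {E B X Y : Type*}
    [TopologicalSpace E] [TopologicalSpace B] [TopologicalSpace X] [TopologicalSpace Y]
    (n : ℕ) (hn : 2 ≤ n) (p : C(E, B)) (q : C(X, Y))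
    (hp : IsHurewiczFibration p) (hq : IsHurewiczFibration q)
    (f' : ContinuousMap.HomotopyEquiv E X) (f : ContinuousMap.HomotopyEquiv B Y)
    (hcomm : q.comp f'.toFun = f.toFun.comp p) :
    sequentialParametrizedTC n p = sequentialParametrizedTC n q := by
  obtain ⟨g', hg', hfg⟩ := exists_fibrewise_rightInverse hp hq f' f hcomm
  -- A right inverse of `g'` gives the other inequality; `h'` need not be compared with `f'`.
  obtain ⟨h', hh', hgh⟩ := exists_fibrewise_rightInverse hq hp g' f.symm hg'
  have hf_pres : FibrePreserving p q f'.toFun := .of_comp_eq f.toFun (DFunLike.congr_fun hcomm)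
  have hg_pres : FibrePreserving q p g'.toFun := .of_comp_eq f.invFun (DFunLike.congr_fun hg')
  have hh_pres : FibrePreserving p q h'.toFun := .of_comp_eq f.toFun (DFunLike.congr_fun hh')
  exact le_antisymm (sequentialParametrizedTC_le hg_pres hh_pres hgh n)
    (sequentialParametrizedTC_le hf_pres hg_pres hfg n)
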